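/- **Setting.** Let $\mathcal K$ be an abstract simplicial complex of dimension at most $N$ in which every $n$-simplex is a face of at most $L$ simplices of dimension $n+1$ ($N,L$ finite). Fix an orientation of every simplex, let $\mathcal K_n$ be the set of (oriented) $n$-simplices, $\mathcal C_n$ the free abelian group on $\mathcal K_n$, $\partial^{\mathcal C}_n x=\sum_{y\in\mathcal K_{n-1}}\epsilon_{x,y}\,y$ the boundary operator with the usual incidence numbers $\epsilon_{x,y}\in\{0,\pm1\}$, and $\widehat\partial^{\mathcal C}_{n+1}x=\sum_{z\in\mathcal K_{n+1}}\epsilon_{z,x}\,z$ the coboundary operator. Let $(\mathbb G_\bullet,\partial^{\mathbb G}_\bullet)$, $\partial^{\mathbb G}_j:\mathbb G_j\to\mathbb G_{j-1}$, be a chain complex of finite abelian groups with $\mathbb G_j=0$ for $j<0$ and $j>N$. Let $\widehat{\mathbb G}_j$ be the group of characters $\mathbb G_j\to U(1)$, written additively, and $\widehat\partial^{\mathbb G}_j:\widehat{\mathbb G}_{j-1}\to\widehat{\mathbb G}_j$, $\alpha\mapsto\alpha\circ\partial^{\mathbb G}_j$. For $p\in\mathbb Z$ let $\mathrm{Hom}_0^p$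 be the group of sequences $t=(t_n)_n$ of homomorphisms $t_n:\mathcal C_n\to\mathbb G_{n-p}$ such that $t_n(x)\ne0$ for only finitely many simplices $x$, and let $\mathrm{Hom}_{0,p}$ be the group of sequences $\gamma=(\gamma_n)_n$ of homomorphisms $\gamma_n:\mathcal C_n\to\widehat{\mathbb G}_{n-p}$ with the same finiteness property. Define $\delta^p:\mathrm{Hom}_0^p\to\mathrm{Hom}_0^{p+1}$ and $\delta_p:\mathrm{Hom}_{0,p}\to\mathrm{Hom}_{0,p-1}$ by $$(\delta^pt)_n=t_{n-1}\circ\partial^{\mathcal C}_n-(-1)^p\,\partial^{\mathbb G}_{n-p}\circ t_n,\qquad(\delta_p\gamma)_n=\gamma_{n+1}\circ\widehat\partial^{\mathcal C}_{n+1}-(-1)^{p-1}\,\widehat\partial^{\mathbb G}_{n+1-p}\circ\gamma_n .$$ For a finite set $\Lambda$ of simplices let $\mathfrak A_\Lambda=\mathcal B\big(\bigotimes_{x\in\Lambda}\mathfrak h_x\big)$, where $\mathfrak h_x=L^2(\mathbb G_n)$ for $x\in\mathcal K_n$ has the orthonormal basis $\{|g\rangle\}_{g\in\mathbb G_n}$.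 Identify $A\in\mathfrak A_\Lambda$ with $A\otimes 1$ in $\mathfrak A_{\Lambda'}$ for $\Lambda\subset\Lambda'$, and let $\mathfrak A$ be the norm closure of $\bigcup_\Lambda\mathfrak A_\Lambda$ (the quasi-local $C^*$-algebra). For $t\in\mathrm{Hom}_0^0$ and $\gamma\in\mathrm{Hom}_{0,0}$ let $P_t,Q_\gamma\in\mathfrak A$ be the products over all $x\in\mathcal K_n$, $n\ge0$, of the operators on $\mathfrak h_x$ given by $|h\rangle\mapsto|t_n(x)+h\rangle$ and $|h\rangle\mapsto\gamma_n(x)[h]\,|h\rangle$ respectively. For $t\in\mathrm{Hom}_0^{-1}$ and $\gamma\in\mathrm{Hom}_{0,1}$ put $A_t=P_{\delta^{-1}t}$ and $B_\gamma=Q_{\delta_1\gamma}$. Let $\mathfrak K\subset\mathfrak A$ be the $C^*$-subalgebra generated by all $A_t$ and $B_\gamma$ (the core algebra), and let $\mathfrak K'=\{T\in\mathfrak A : TS=ST\text{ for all }S\in\mathfrak K\}$ be its commutant in $\mathfrak A$. **Lemma.** The commutant of the core algebra is the norm closure of the linear span of the Weyl monomials $P_tQ_\gamma$ with $t\in\mathrm{Ker}\,\delta^0$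 and $\gamma\in\mathrm{Ker}\,\delta_0$: $$\mathfrak K'=\overline{\mathrm{span}\,\{P_tQ_\gamma : t\in\mathrm{Hom}_0^0,\ \delta^0t=0,\ \gamma\in\mathrm{Hom}_{0,0},\ \delta_0\gamma=0\}}^{\,\|\cdot\|}.$$ -/

import Mathlib

namespace HAQDM

open CategoryTheory

universe u w

/-! ### Geometric data -/

/-- An `N`-dimensional, `L`-regular simplicial complex on the vertex set `V`, together with an
orientation of each of its simplices. The linear order of `V` only serves as a reference to name
the two orientations of a simplex: if `v₀ < ... < vₙ` are the vertices of `s`, then `orient s = 1`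
selects `[v₀, ..., vₙ]` and `orient s = -1` selects `-[v₀, ..., vₙ]`. Every choice of orientations
arises in this way. A vertex has only one orientation. -/
structure OrientedComplex (V : Type u) [LinearOrder V] (N L : ℕ)
    extends AbstractSimplicialComplex V where
  /-- the chosen orientation of each simplex (irrelevant outside the complex) -/
  orient : Finset V → ℤˣ
  orient_vertex : ∀ v, orient {v} = 1
  /-- there are no `n`-simplices with `n > N` -/
  card_le : ∀ s ∈ faces, s.card ≤ N + 1
  /-- each `n`-simplex is a face of at most `L` simplices of dimension `n + 1` -/
  regular : ∀ s ∈ faces, {z ∈ faces | s ⊆ z ∧ z.card = s.card + 1}.encard ≤ (L : ℕ∞)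

section Geometry

variable {V : Type u} [LinearOrder V] {N L : ℕ} (K : OrientedComplex V N L)

/-- The simplices of the complex, of all dimensions. -/
abbrev Simplex : Type u := {s : Finset V // s ∈ K.faces}

/-- The dimension of a simplex. -/
def dim (x : Simplex K) : ℤ := (x.1.card : ℤ) - 1

/-- The set of `n`-simplices, for `n : ℤ` (it is empty for `n < 0`). -/
abbrev SimplexOfDim (n : ℤ) : Type u := {x : Simplex K // dim K x = n}

/-- The group `Cₙ` of `n`-chains: the free abelian group on the (oriented) `n`-simplices. -/
abbrev Chain (n : ℤ) : Type u := SimplexOfDim K n →₀ ℤ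

/-- The incidence number `ε_{x,y}`: it is `± 1` if `y` is obtained from `x` by removing a vertex,
the sign being that of the oriented face `y` in the boundary of `x`, and `0` otherwise. -/
def incidence (x y : Simplex K) : ℤ :=
  (K.orient x.1 : ℤ) * (K.orient y.1 : ℤ) *
    ∑ v ∈ x.1, if y.1 = x.1.erase v then (-1) ^ (x.1.filter (· < v)).card else 0

theorem incidence_ne_zero {x y : Simplex K} (h : incidence K x y ≠ 0) :
    y.1 ⊆ x.1 ∧ x.1.card = y.1.card + 1 := by
  obtain ⟨v, hv, hne⟩ := Finset.exists_ne_zero_of_sum_ne_zero (right_ne_zero_of_mul h)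
  have hy : y.1 = x.1.erase v := by
    by_contra hy
    simp [hy] at hne
  rw [hy]
  exact ⟨Finset.erase_subset _ _, (Finset.card_erase_add_one hv).symm⟩

theorem finite_incidence_right (x : Simplex K) : {y | incidence K x y ≠ 0}.Finite :=
  Set.Finite.of_finite_image
    ((x.1.powerset.finite_toSet).subset (by
      rintro _ ⟨y, hy, rfl⟩
      simpa using (incidence_ne_zero K hy).1)) Subtype.val_injective.injOn

theorem finite_incidence_left (y : Simplex K) : {x | incidence K x y ≠ 0}.Finite :=
  Set.Finite.of_finite_image
    ((Set.finite_of_encard_le_coe (K.regular y.1 y.2)).subset (by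
      rintro _ ⟨x, hx, rfl⟩
      exact ⟨x.2, incidence_ne_zero K hx⟩)) Subtype.val_injective.injOn

/-- The boundary operator, on generators `∂ x = ∑ y, ε_{x,y} y`, as a map `Cₙ → Cₘ`.
It is used for `m = n - 1`. -/
noncomputable def boundary (n m : ℤ) : Chain K n →+ Chain K m :=
  Finsupp.liftAddHom fun x => (zmultiplesHom (Chain K m))
    (Finsupp.ofSupportFinite (fun y : SimplexOfDim K m => incidence K x.1 y.1)
      ((finite_incidence_right K x.1).preimage Subtype.val_injective.injOn))

/-- The coboundary operator, on generators `x ↦ ∑ z, ε_{z,x} z`, as a map `Cₙ → Cₘ`.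
It is used for `m = n + 1`. -/
noncomputable def coboundary (n m : ℤ) : Chain K n →+ Chain K m :=
  Finsupp.liftAddHom fun x => (zmultiplesHom (Chain K m))
    (Finsupp.ofSupportFinite (fun z : SimplexOfDim K m => incidence K z.1 x.1)
      ((finite_incidence_left K x.1).preimage Subtype.val_injective.injOn))

/-- The simplex `x` as a generator of the group of chains. -/
noncomputable def gen (x : Simplex K) : Chain K (dim K x) := Finsupp.single ⟨x, rfl⟩ 1

/-! ### `p`-maps and dual `p`-maps -/

/-- The boundary map of the algebraic data, `∂ : G_i → G_j` (nonzero only for `j = i - 1`). -/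
def bdG (G : ChainComplex AddCommGrpCat.{w} ℤ) (i j : ℤ) : G.X i →+ G.X j := (G.d i j).hom

/-- The (Pontryagin) dual group of `G_j`: the characters `G_j → U(1)`, written additively. -/
abbrev Dual (G : ChainComplex AddCommGrpCat.{w} ℤ) (j : ℤ) : Type w := AddChar (G.X j) Circle

/-- The adjoint boundary map `Ĝ_j → Ĝ_i`, `α ↦ α ∘ ∂`, for `∂ : G_i → G_j`. -/
noncomputable def dualBdG (G : ChainComplex AddCommGrpCat.{w} ℤ) (i j : ℤ) : Dual G j →+ Dual G i where
  toFun α := α.compAddMonoidHom (bdG G i j)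
  map_zero' := rfl
  map_add' _ _ := rfl

variable (G : ChainComplex AddCommGrpCat.{w} ℤ)

/-- Families of homomorphisms `t_{n,j} : Cₙ → G_j`. -/
abbrev Family : Type (max u w) := ∀ n j : ℤ, Chain K n →+ G.X j

/-- Families of homomorphisms `γ_{n,j} : Cₙ → Ĝ_j`. -/
abbrev DualFamily : Type (max u w) := ∀ n j : ℤ, Chain K n →+ Dual G j

variable {K G}

/-- The support: the simplices `x` with `t_n(x) ≠ 0`, where `n = dim x`. -/
def Family.support (t : Family K G) : Set (Simplex K) :=
  {x | ∃ j, t (dim K x) j (gen K x) ≠ 0}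

/-- The support: the simplices `x` with `γ_n(x) ≠ 0`, where `n = dim x`. -/
def DualFamily.support (γ : DualFamily K G) : Set (Simplex K) :=
  {x | ∃ j, γ (dim K x) j (gen K x) ≠ 0}

variable (K G)

/-- The compactly supported `p`-maps `Hom₀(C, G)^p`: sequences of homomorphisms
`t_n : Cₙ → G_{n - p}` (so the component `t_{n,j}` vanishes unless `n = j + p`)
with finite support. -/
def Hom₀ (p : ℤ) : AddSubgroup (Family K G) where
  carrier := {t | (∀ n j, n ≠ j + p → t n j = 0) ∧ t.support.Finite}
  zero_mem' := ⟨fun _ _ _ => rfl, by simp [Family.support]⟩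
  add_mem' := by
    rintro s t ⟨hs, hs'⟩ ⟨ht, ht'⟩
    refine ⟨fun n j h => by simp [hs n j h, ht n j h], (hs'.union ht').subset ?_⟩
    rintro x ⟨j, hj⟩
    by_contra hx
    simp only [Set.mem_union, Family.support, Set.mem_ofPred_eq, not_or, not_exists,
      not_not] at hx
    exact hj (by simp [hx.1 j, hx.2 j])
  neg_mem' := by
    rintro t ⟨ht, ht'⟩
    exact ⟨fun n j h => by simp [ht n j h], by simpa [Family.support] using ht'⟩

/-- The compactly supported dual `p`-maps `Hom₀(C, G)_p`: sequences of homomorphisms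
`γ_n : Cₙ → Ĝ_{n - p}` (so the component `γ_{n,j}` vanishes unless `n = j + p`)
with finite support. -/
def DualHom₀ (p : ℤ) : AddSubgroup (DualFamily K G) where
  carrier := {γ | (∀ n j, n ≠ j + p → γ n j = 0) ∧ γ.support.Finite}
  zero_mem' := ⟨fun _ _ _ => rfl, by simp [DualFamily.support]⟩
  add_mem' := by
    rintro s t ⟨hs, hs'⟩ ⟨ht, ht'⟩
    refine ⟨fun n j h => by simp [hs n j h, ht n j h], (hs'.union ht').subset ?_⟩
    rintro x ⟨j, hj⟩
    by_contra hx
    simp only [Set.mem_union, DualFamily.support, Set.mem_ofPred_eq, not_or, not_exists,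
      not_not] at hx
    exact hj (by simp [hx.1 j, hx.2 j])
  neg_mem' := by
    rintro t ⟨ht, ht'⟩
    exact ⟨fun n j h => by simp [ht n j h], by simpa [DualFamily.support] using ht'⟩

/-- `(δ^p t)_n = t_{n-1} ∘ ∂_n - (-1)^p ∂ ∘ t_n`. -/
noncomputable def δFam (p : ℤ) : Family K G →+ Family K G where
  toFun t n j := (t (n - 1) j).comp (boundary K n (n - 1)) -
    (p.negOnePow : ℤ) • (bdG G (j + 1) j).comp (t n (j + 1))
  map_zero' := by
    funext n j
    ext
    simp
  map_add' s t := by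
    funext n j
    ext x
    simp [smul_add]
    abel

/-- `(δ_p γ)_n = γ_{n+1} ∘ ∂̂_{n+1} - (-1)^(p-1) ∂̂ ∘ γ_n`. -/
noncomputable def δDualFam (p : ℤ) : DualFamily K G →+ DualFamily K G where
  toFun γ n j := (γ (n + 1) j).comp (coboundary K n (n + 1)) -
    ((p - 1).negOnePow : ℤ) • (dualBdG G j (j - 1)).comp (γ n (j - 1))
  map_zero' := by
    funext n j
    refine AddMonoidHom.ext fun x => ?_
    simp
  map_add' s t := by
    funext n j
    refine AddMonoidHom.ext fun x => ?_
    simp [zsmul_add]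
    abel

variable {K G}

theorem hom_chain_eq_zero {A : Type*} [AddCommGroup A] {m : ℤ} (f : Chain K m →+ A) (c : Chain K m)
    (h : ∀ y, c y ≠ 0 → f (Finsupp.single y 1) = 0) : f c = 0 := by
  rw [← Finsupp.sum_single c, Finsupp.sum, map_sum]
  refine Finset.sum_eq_zero fun y hy => ?_
  have : Finsupp.single y (c y) = c y • Finsupp.single y (1 : ℤ) := by simp
  rw [this, map_zsmul, h y (by simpa using hy), zsmul_zero]

theorem boundary_gen_apply (x : Simplex K) (m : ℤ) (y : SimplexOfDim K m) :
    boundary K (dim K x) m (gen K x) y = incidence K x y.1 := by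
  simp [boundary, gen, Finsupp.ofSupportFinite]
  rfl

theorem coboundary_gen_apply (x : Simplex K) (m : ℤ) (z : SimplexOfDim K m) :
    coboundary K (dim K x) m (gen K x) z = incidence K z.1 x := by
  simp [coboundary, gen, Finsupp.ofSupportFinite]
  rfl

theorem Family.eq_zero_of_notMem {t : Family K G} {n : ℤ} (y : SimplexOfDim K n)
    (hy : y.1 ∉ t.support) (j : ℤ) : t n j (Finsupp.single y 1) = 0 := by
  obtain ⟨y, rfl⟩ := y
  by_contra h
  exact hy ⟨j, h⟩

theorem DualFamily.eq_zero_of_notMem {γ : DualFamily K G} {n : ℤ} (y : SimplexOfDim K n)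
    (hy : y.1 ∉ γ.support) (j : ℤ) : γ n j (Finsupp.single y 1) = 0 := by
  obtain ⟨y, rfl⟩ := y
  by_contra h
  exact hy ⟨j, h⟩

theorem δFam_mem {p q : ℤ} (h : p + 1 = q) {t : Family K G} (ht : t ∈ Hom₀ K G p) :
    δFam K G p t ∈ Hom₀ K G q := by
  subst h
  obtain ⟨h0, hfin⟩ := ht
  refine ⟨fun n j hn => ?_, ?_⟩
  · simp [δFam, h0 (n - 1) j (by omega), h0 n (j + 1) (by omega)]
  · refine (hfin.union (hfin.biUnion fun y _ => finite_incidence_left K y)).subset ?_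
    rintro x ⟨j, hj⟩
    by_contra hx
    simp only [Set.mem_union, Set.mem_iUnion, Set.mem_ofPred_eq, not_or, not_exists] at hx
    refine hj ?_
    have h1 : t (dim K x - 1) j (boundary K (dim K x) (dim K x - 1) (gen K x)) = 0 := by
      refine hom_chain_eq_zero _ _ fun y hy => Family.eq_zero_of_notMem y (fun hmem => ?_) j
      rw [boundary_gen_apply] at hy
      exact hx.2 y.1 hmem hy
    have h2 : t (dim K x) (j + 1) (gen K x) = 0 := Family.eq_zero_of_notMem ⟨x, rfl⟩ hx.1 _
    simp [δFam, h1, h2]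

theorem δDualFam_mem {p q : ℤ} (h : q + 1 = p) {γ : DualFamily K G} (hγ : γ ∈ DualHom₀ K G p) :
    δDualFam K G p γ ∈ DualHom₀ K G q := by
  subst h
  obtain ⟨h0, hfin⟩ := hγ
  refine ⟨fun n j hn => ?_, ?_⟩
  · refine AddMonoidHom.ext fun x => ?_
    simp [δDualFam, h0 (n + 1) j (by omega), h0 n (j - 1) (by omega)]
  · refine (hfin.union (hfin.biUnion fun y _ => finite_incidence_right K y)).subset ?_
    rintro x ⟨j, hj⟩
    by_contra hx
    simp only [Set.mem_union, Set.mem_iUnion, Set.mem_ofPred_eq, not_or, not_exists] at hx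
    refine hj ?_
    have h1 : γ (dim K x + 1) j (coboundary K (dim K x) (dim K x + 1) (gen K x)) = 0 := by
      refine hom_chain_eq_zero _ _ fun y hy => DualFamily.eq_zero_of_notMem y (fun hmem => ?_) j
      rw [coboundary_gen_apply] at hy
      exact hx.2 y.1 hmem hy
    have h2 : γ (dim K x) (j - 1) (gen K x) = 0 := DualFamily.eq_zero_of_notMem ⟨x, rfl⟩ hx.1 _
    simp [δDualFam, h1, h2]
    exact zsmul_zero _

variable (K G)

/-- The coboundary map `δ^p : Hom₀(C, G)^p → Hom₀(C, G)^q`, where `q = p + 1`. -/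
noncomputable def δUp (p q : ℤ) (h : p + 1 = q) : Hom₀ K G p →+ Hom₀ K G q :=
  ((δFam K G p).comp (Hom₀ K G p).subtype).codRestrict _ fun t => δFam_mem h t.2

/-- The boundary map `δ_p : Hom₀(C, G)_p → Hom₀(C, G)_q`, where `q = p - 1`. -/
noncomputable def δDown (p q : ℤ) (h : q + 1 = p) : DualHom₀ K G p →+ DualHom₀ K G q :=
  ((δDualFam K G p).comp (DualHom₀ K G p).subtype).codRestrict _ fun γ => δDualFam_mem h γ.2

end Geometry

/-! ### The quasi-local algebra -/

section Algebra

variable {V : Type u} [LinearOrder V] {N L : ℕ} (K : OrientedComplex V N L)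
  (G : ChainComplex AddCommGrpCat.{w} ℤ)

/-- Configurations: assignments of an element of `G_n` to each `n`-simplex, zero outside a finite
set of simplices. -/
def Conf : AddSubgroup (∀ x : Simplex K, G.X (dim K x)) where
  carrier := {c | {x | c x ≠ 0}.Finite}
  zero_mem' := by simp
  add_mem' := by
    intro a b ha hb
    refine (ha.union hb).subset fun x hx => ?_
    by_contra h
    simp only [Set.mem_union, Set.mem_ofPred_eq, not_or, not_not] at h
    exact hx (by simp [h.1, h.2])
  neg_mem' := by
    intro a ha
    simpa using ha

/-- The configurations on a finite set `Λ` of simplices. They index the canonical basis of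
`⨂_{x ∈ Λ} L²(G_{dim x})`. -/
abbrev LocalConf (Λ : Finset (Simplex K)) : Type (max u w) := ∀ x : Λ, G.X (dim K x.1)

/-- The Hilbert space `ℓ²` with orthonormal basis indexed by the configurations: the tensor product
of all the `L²(G_{dim x})`, taken along the reference vectors `|0⟩`. The local algebras act on it
faithfully. -/
abbrev H : Type (max u w) := lp (fun _ : Conf K G => ℂ) 2

variable {K G}

open Classical in
/-- The canonical orthonormal basis `|c⟩`. -/
noncomputable def ket (c : Conf K G) : H K G := lp.single 2 c 1

open Classical in
theorem inner_ket (c d : Conf K G) : inner ℂ (ket c) (ket d) = if c = d then (1 : ℂ) else 0 := by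
  rw [ket, ket, lp.inner_single_left]
  by_cases h : c = d
  · subst h; simp
  · simp [h]

theorem orthonormal_ket : Orthonormal ℂ (ket : Conf K G → H K G) := by
  classical
  rw [orthonormal_iff_ite]
  exact inner_ket

/-- The isometry that maps the canonical basis to the orthonormal family `v`. -/
noncomputable def ofOrthonormal (v : Conf K G → H K G) (hv : Orthonormal ℂ v) :
    H K G →L[ℂ] H K G :=
  hv.orthogonalFamily.linearIsometry.toContinuousLinearMap

@[simp] theorem ofOrthonormal_ket (v : Conf K G → H K G) (hv : Orthonormal ℂ v) (c : Conf K G) :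
    ofOrthonormal v hv (ket c) = v c := by
  classical
  simp only [ofOrthonormal, ket, LinearIsometry.coe_toContinuousLinearMap]
  rw [OrthogonalFamily.linearIsometry_apply_single]
  simp

/-- The shift by the configuration `t`: `|c⟩ ↦ |t + c⟩`. -/
noncomputable def shift (t : Conf K G) : H K G →L[ℂ] H K G :=
  ofOrthonormal (fun c => ket (t + c)) (orthonormal_ket.comp _ (add_right_injective t))

@[simp] theorem shift_ket (t c : Conf K G) : shift t (ket c) = ket (t + c) := by
  simp [shift]

/-- Multiplication of the basis vectors by phases: `|c⟩ ↦ φ c |c⟩`. -/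
noncomputable def clock (φ : Conf K G → Circle) : H K G →L[ℂ] H K G :=
  ofOrthonormal (fun c => (φ c : ℂ) • ket c) (by
    classical
    rw [orthonormal_iff_ite]
    intro c d
    rw [inner_smul_left, inner_smul_right, inner_ket]
    split_ifs with h
    · subst h
      simpa [Circle.normSq_coe] using Complex.normSq_eq_conj_mul_self (z := (φ c : ℂ)) |>.symm
    · simp)

@[simp] theorem clock_ket (φ : Conf K G → Circle) (c : Conf K G) :
    clock φ (ket c) = (φ c : ℂ) • ket c := by
  simp [clock]

/-- Two bounded operators that agree on the canonical basis are equal. -/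
theorem ext_ket {S T : H K G →L[ℂ] H K G} (h : ∀ c, S (ket c) = T (ket c)) : S = T := by
  classical
  refine lp.ext_continuousLinearMap (by simp) fun c => ?_
  refine ContinuousLinearMap.ext_ring ?_
  simpa [ket] using h c

theorem ext_inner_ket {u v : H K G} (h : ∀ c, inner ℂ (ket c) u = inner ℂ (ket c) v) : u = v := by
  classical
  refine lp.ext (funext fun c => ?_)
  simpa [ket, lp.inner_single_left] using h c

/-- Restriction of a configuration to `Λ`. -/
def res (Λ : Finset (Simplex K)) (c : Conf K G) : LocalConf K G Λ := fun x => c.1 x.1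

open Classical in
/-- Extension of a configuration on `Λ` by zero. -/
noncomputable def extend (Λ : Finset (Simplex K)) (d : LocalConf K G Λ) : Conf K G :=
  ⟨fun x => if h : x ∈ Λ then d ⟨x, h⟩ else 0,
    Λ.finite_toSet.subset fun x hx => by
      by_contra h
      exact hx (dif_neg h)⟩

theorem res_patch (Λ : Finset (Simplex K)) (d : LocalConf K G Λ) (c : Conf K G) :
    res Λ (extend Λ d - extend Λ (res Λ c) + c) = d := by
  funext x
  simp [res, extend]

theorem res_extend (Λ : Finset (Simplex K)) (d : LocalConf K G Λ) : res Λ (extend Λ d) = d := by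
  funext x
  simp [res, extend]

/-- The orthogonal projection onto the closed span of the `|c⟩` with `c = d` on `Λ`. -/
noncomputable def proj (Λ : Finset (Simplex K)) (d : LocalConf K G Λ) : H K G →L[ℂ] H K G :=
  (Submodule.span ℂ (ket '' {c | res Λ c = d})).topologicalClosure.starProjection

open Classical in
theorem proj_ket (Λ : Finset (Simplex K)) (d : LocalConf K G Λ) (c : Conf K G) :
    proj Λ d (ket c) = if res Λ c = d then ket c else 0 := by
  split_ifs with h
  · refine Submodule.starProjection_eq_self_iff.2 (Submodule.le_topologicalClosure _ ?_)
    exact Submodule.subset_span ⟨c, h, rfl⟩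
  · refine (Submodule.starProjection_apply_eq_zero_iff _).2 ?_
    rw [Submodule.orthogonal_closure, Submodule.mem_orthogonal]
    intro u hu
    induction hu using Submodule.span_induction with
    | mem u hu =>
      obtain ⟨e, he, rfl⟩ := hu
      rw [inner_ket, if_neg]
      rintro rfl
      exact h he
    | zero => simp
    | add u v _ _ hu hv => simp [inner_add_left, hu, hv]
    | smul a u _ hu => simp [inner_smul_left, hu]

variable [∀ j, Finite (G.X j)]

noncomputable instance (Λ : Finset (Simplex K)) : Fintype (LocalConf K G Λ) := Fintype.ofFinite _

noncomputable instance (Λ : Finset (Simplex K)) : DecidableEq (LocalConf K G Λ) :=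
  Classical.decEq _

/-- The operator `a ⊗ 1` on `H`, for a matrix `a` indexed by the configurations on `Λ`. -/
noncomputable def localOp (Λ : Finset (Simplex K))
    (a : Matrix (LocalConf K G Λ) (LocalConf K G Λ) ℂ) : H K G →L[ℂ] H K G :=
  ∑ d, ∑ d', a d d' • (shift (extend Λ d - extend Λ d') * proj Λ d')

/-- `a ⊗ 1` acts on `|c⟩` by changing the configuration inside `Λ` only. -/
theorem localOp_ket (Λ : Finset (Simplex K)) (a : Matrix (LocalConf K G Λ) (LocalConf K G Λ) ℂ)
    (c : Conf K G) :
    localOp Λ a (ket c) =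
      ∑ d, a d (res Λ c) • ket (extend Λ d - extend Λ (res Λ c) + c) := by
  simp only [localOp, sum_apply, smul_apply, mul_apply_eq_comp, proj_ket]
  refine Finset.sum_congr rfl fun d _ => ?_
  rw [Finset.sum_eq_single (res Λ c)]
  · simp
  · intro b _ hb
    simp [hb.symm]
  · simp

open Classical in
theorem inner_localOp (Λ : Finset (Simplex K)) (a : Matrix (LocalConf K G Λ) (LocalConf K G Λ) ℂ)
    (c c' : Conf K G) :
    inner ℂ (ket c') (localOp Λ a (ket c)) =
      if c' = extend Λ (res Λ c') - extend Λ (res Λ c) + c then a (res Λ c') (res Λ c) else 0 := by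
  simp only [localOp_ket, inner_sum, inner_smul_right, inner_ket]
  rw [Finset.sum_eq_single (res Λ c')]
  · simp
  · intro d _ hd
    rw [if_neg, mul_zero]
    intro h
    exact hd (by rw [h, res_patch])
  · simp

theorem localOp_conjTranspose (Λ : Finset (Simplex K))
    (a : Matrix (LocalConf K G Λ) (LocalConf K G Λ) ℂ) :
    localOp Λ a.conjTranspose = star (localOp Λ a) := by
  classical
  refine ext_ket fun c => ext_inner_ket fun c' => ?_
  rw [ContinuousLinearMap.star_eq_adjoint, ContinuousLinearMap.adjoint_inner_right,
    ← inner_conj_symm (localOp Λ a (ket c')), inner_localOp, inner_localOp]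
  have h : c' = extend Λ (res Λ c') - extend Λ (res Λ c) + c ↔
      c = extend Λ (res Λ c) - extend Λ (res Λ c') + c' := by
    generalize extend Λ (res Λ c') = A
    generalize extend Λ (res Λ c) = B
    constructor
    · rintro rfl
      abel
    · intro h
      rw [h]
      abel
  by_cases hc : c = extend Λ (res Λ c) - extend Λ (res Λ c') + c'
  · rw [if_pos hc, if_pos (h.2 hc), Matrix.conjTranspose_apply]
    rfl
  · rw [if_neg hc, if_neg (mt h.1 hc), map_zero]

/-- The embedding `a ↦ a ⊗ 1` of the matrices indexed by the configurations on `Λ`. -/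
noncomputable def matrixEmbedding (Λ : Finset (Simplex K)) :
    Matrix (LocalConf K G Λ) (LocalConf K G Λ) ℂ →⋆ₐ[ℂ] (H K G →L[ℂ] H K G) where
  toFun := localOp Λ
  map_one' := by
    refine ext_ket fun c => ?_
    rw [localOp_ket, Finset.sum_eq_single (res Λ c)]
    · simp
    · intro d _ hd
      simp [Matrix.one_apply_ne hd]
    · simp
  map_mul' a b := by
    refine ext_ket fun c => ?_
    simp only [mul_apply_eq_comp, localOp_ket, map_sum, map_smul, res_patch,
      Matrix.mul_apply, Finset.sum_smul, Finset.smul_sum, smul_smul]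
    rw [Finset.sum_comm]
    refine Finset.sum_congr rfl fun e _ => Finset.sum_congr rfl fun d _ => ?_
    rw [mul_comm]
    congr 2
    abel
  map_zero' := by simp [localOp]
  map_add' a b := by simp [localOp, add_smul, Finset.sum_add_distrib]
  commutes' r := by
    refine ext_ket fun c => ?_
    rw [localOp_ket, Finset.sum_eq_single (res Λ c)]
    · simp [Algebra.algebraMap_eq_smul_one]
    · intro d _ hd
      simp [Matrix.algebraMap_matrix_apply, hd]
    · simp
  map_star' a := by
    exact localOp_conjTranspose Λ a

/-- The embedding `B(⨂_{x ∈ Λ} L²(G_{dim x})) → B(H)`, `A ↦ A ⊗ 1`. -/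
noncomputable def localEmbedding (Λ : Finset (Simplex K)) :
    (EuclideanSpace ℂ (LocalConf K G Λ) →L[ℂ] EuclideanSpace ℂ (LocalConf K G Λ)) →⋆ₐ[ℂ]
      (H K G →L[ℂ] H K G) :=
  (matrixEmbedding Λ).comp
    ((Matrix.toEuclideanCLM (n := LocalConf K G Λ) (𝕜 := ℂ)).symm : _ →⋆ₐ[ℂ] _)

theorem localEmbedding_injective (Λ : Finset (Simplex K)) :
    Function.Injective (localEmbedding (K := K) (G := G) Λ) := by
  refine Function.Injective.comp (g := matrixEmbedding Λ) (fun a b hab => ?_)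
    (Matrix.toEuclideanCLM (n := LocalConf K G Λ) (𝕜 := ℂ)).symm.injective
  have hab' : localOp Λ a = localOp Λ b := hab
  ext d d'
  have h := congrArg (fun T => inner ℂ (ket (extend Λ d)) (T (ket (extend Λ d')))) hab'
  simpa [inner_localOp, res_extend] using h

variable (K G)

/-- The local algebra `𝔄_Λ`, as an algebra of operators on `H`. -/
noncomputable def localAlgebra (Λ : Finset (Simplex K)) : StarSubalgebra ℂ (H K G →L[ℂ] H K G) :=
  (localEmbedding (K := K) (G := G) Λ).range

/-- The algebra `𝔄_loc` of local observables: the union of all the `𝔄_Λ`. -/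
def localObservables : Set (H K G →L[ℂ] H K G) :=
  ⋃ Λ : Finset (Simplex K), (localAlgebra K G Λ : Set (H K G →L[ℂ] H K G))

/-- The quasi-local algebra `𝔄`: the norm closure of `𝔄_loc`. -/
def quasiLocalAlgebra : Set (H K G →L[ℂ] H K G) := closure (localObservables K G)

variable {K G}

/-! ### Weyl monomials, the core algebra and its commutant -/

/-- The configuration `x ↦ t_n(x)` (`n = dim x`) given by a compactly supported `0`-map. -/
noncomputable def toConf (t : Hom₀ K G 0) : Conf K G :=
  ⟨fun x => t.1 (dim K x) (dim K x) (gen K x), t.2.2.subset fun _ hx => ⟨_, hx⟩⟩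

/-- The value `γ(c) = ∏_x γ_n(x)[c(x)]` (`n = dim x`) of a compactly supported dual `0`-map on a
configuration. Only finitely many factors differ from `1`. -/
noncomputable def pairing (γ : DualHom₀ K G 0) (c : Conf K G) : Circle :=
  ∏ᶠ x : Simplex K, γ.1 (dim K x) (dim K x) (gen K x) (c.1 x)

/-- The shift operator `P_t |c⟩ = |t + c⟩`. -/
noncomputable def P (t : Hom₀ K G 0) : H K G →L[ℂ] H K G := shift (toConf t)

/-- The clock operator `Q_γ |c⟩ = γ(c) |c⟩`. -/
noncomputable def Q (γ : DualHom₀ K G 0) : H K G →L[ℂ] H K G := clock (pairing γ)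

/-- The operator `A_t = P_{δ^{-1} t}`. -/
noncomputable def A (t : Hom₀ K G (-1)) : H K G →L[ℂ] H K G := P (δUp K G (-1) 0 (by norm_num) t)

/-- The operator `B_γ = Q_{δ_1 γ}`. -/
noncomputable def B (γ : DualHom₀ K G 1) : H K G →L[ℂ] H K G := Q (δDown K G 1 0 (by norm_num) γ)

variable (K G)

/-- The core algebra `𝔎`: the `C*`-algebra generated by all the `A_t` and `B_γ`. -/
noncomputable def coreAlgebra : StarSubalgebra ℂ (H K G →L[ℂ] H K G) :=
  (StarAlgebra.adjoin ℂ (Set.range (A (K := K) (G := G)) ∪ Set.range B)).topologicalClosure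

/-- The commutant `𝔎'`: the elements of `𝔄` that commute with every element of `𝔎`. -/
def commutant : Set (H K G →L[ℂ] H K G) :=
  quasiLocalAlgebra K G ∩ Set.centralizer (coreAlgebra K G : Set (H K G →L[ℂ] H K G))

/-- The set `ℨ` of the Weyl monomials `P_t Q_γ` with `t ∈ Ker δ^0` and `γ ∈ Ker δ_0`. -/
def units : Set (H K G →L[ℂ] H K G) :=
  {T | ∃ t ∈ (δUp K G 0 1 (by norm_num)).ker, ∃ γ ∈ (δDown K G 0 (-1) (by norm_num)).ker,
    T = P t * Q γ}

end Algebra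
end HAQDM

/-! Weyl monomials commute up to phases: `Q_mul_P` gives Q_γ P_t = γ(t) P_t Q_γ. Hence conjugation
by A_s multiplies P_t Q_γ by the inverse of γ(δ^{-1}s), and conjugation by B_η multiplies it by
(δ_1η)(t). Since δ^p and δ_{p+1} are adjoint (`prod_δFam_eq_prod_δDualFam`), these phases are the
inverse of (δ_0γ)(s), and η(δ^0t). They are all trivial when γ and t lie in the kernels. Otherwise a
map concentrated on one simplex produces a phase χ ≠ 1, and χ is a root of unity because the groups
are finite.

Every local operator is a finite combination of Weyl monomials, because indicator functions on a
finite abelian group are combinations of characters (`localObservables_subset_span`). Let T be in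
the commutant and T₀ a local operator near T. If a monomial of T₀ has t or γ outside the kernels,
choose a generator U giving it a phase χ ≠ 1 with χ^m = 1, and average over conjugation by U^k, k <
m. The average is a contraction that fixes T, kills this monomial (geometric sum) and only rescales
the others. After finitely many averages a combination of kernel monomials remains, no farther from
T than T₀ was (`exists_mem_span_norm_sub_le`).

For the converse, kernel monomials are local and commute with all generators, and the commutant is
norm closed. -/

namespace HAQDM

open CategoryTheory

universe u w

/-! ### Chain homomorphisms with prescribed values on simplices -/

section Values

variable {V : Type u} [LinearOrder V] {N L : ℕ} {K : OrientedComplex V N L}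

/-- The family of homomorphisms `Cₙ → M j` with prescribed values on the simplices. -/
noncomputable def ofValues {M : ℤ → Type w} [∀ j, AddCommGroup (M j)]
    (f : Simplex K → ∀ j, M j) (n j : ℤ) : Chain K n →+ M j :=
  Finsupp.liftAddHom fun y => zmultiplesHom (M j) (f y.1 j)

@[simp] theorem ofValues_gen {M : ℤ → Type w} [∀ j, AddCommGroup (M j)]
    (f : Simplex K → ∀ j, M j) (x : Simplex K) (j : ℤ) :
    ofValues f (dim K x) j (gen K x) = f x j := by
  simp [ofValues, gen]

theorem ofValues_eq_zero {M : ℤ → Type w} [∀ j, AddCommGroup (M j)]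
    {f : Simplex K → ∀ j, M j} {n j : ℤ} (h : ∀ x, dim K x = n → f x j = 0) :
    ofValues f n j = 0 := by
  refine Finsupp.addHom_ext fun y a => ?_
  simp [ofValues, h y.1 y.2]

variable {G : ChainComplex AddCommGrpCat.{w} ℤ}

theorem ofValues_mem_Hom₀ {p : ℤ} {f : Simplex K → ∀ j, G.X j}
    (hf : ∀ x j, dim K x ≠ j + p → f x j = 0) (hfin : {x | ∃ j, f x j ≠ 0}.Finite) :
    (ofValues f : Family K G) ∈ Hom₀ K G p := by
  refine ⟨fun n j h => ofValues_eq_zero fun x hx => hf x j (hx ▸ h), hfin.subset ?_⟩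
  rintro x ⟨j, hj⟩
  exact ⟨j, by simpa using hj⟩

theorem ofValues_mem_DualHom₀ {p : ℤ} {f : Simplex K → ∀ j, Dual G j}
    (hf : ∀ x j, dim K x ≠ j + p → f x j = 0) (hfin : {x | ∃ j, f x j ≠ 0}.Finite) :
    (ofValues f : DualFamily K G) ∈ DualHom₀ K G p := by
  refine ⟨fun n j h => ofValues_eq_zero fun x hx => hf x j (hx ▸ h), hfin.subset ?_⟩
  rintro x ⟨j, hj⟩
  exact ⟨j, by simpa using hj⟩

theorem pi_single_eq_zero {M : ℤ → Type w} [∀ j, AddCommGroup (M j)] [DecidableEq (Simplex K)]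
    {p : ℤ} (x : Simplex K) (j : ℤ) (h : dim K x = j + p) (g : M j) (y : Simplex K) (i : ℤ)
    (hy : dim K y ≠ i + p) :
    (Pi.single x (Pi.single j g) : Simplex K → ∀ j, M j) y i = 0 := by
  by_cases hxy : y = x
  · subst hxy
    have : i ≠ j := by rintro rfl; exact hy h
    simp [this]
  · simp [hxy]

theorem pi_single_finite {M : ℤ → Type w} [∀ j, AddCommGroup (M j)] [DecidableEq (Simplex K)]
    (x : Simplex K) (j : ℤ) (g : M j) :
    {y | ∃ i, (Pi.single x (Pi.single j g) : Simplex K → ∀ j, M j) y i ≠ 0}.Finite := by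
  refine (Set.finite_singleton x).subset ?_
  rintro y ⟨i, hi⟩
  by_contra hxy
  exact hi (by simp [show y ≠ x from hxy])

open Classical in
/-- The `p`-map with value `g` at `x` and zero at the other simplices. -/
noncomputable def singleHom (p : ℤ) (x : Simplex K) (j : ℤ) (h : dim K x = j + p) (g : G.X j) :
    Hom₀ K G p :=
  ⟨ofValues (Pi.single x (Pi.single j g)),
    ofValues_mem_Hom₀ (pi_single_eq_zero (M := fun j => G.X j) x j h g)
      (pi_single_finite (M := fun j => G.X j) x j g)⟩

open Classical in
/-- The dual `p`-map with value `α` at `x` and zero at the other simplices. -/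
noncomputable def singleDualHom (p : ℤ) (x : Simplex K) (j : ℤ) (h : dim K x = j + p)
    (α : Dual G j) : DualHom₀ K G p :=
  ⟨ofValues (Pi.single x (Pi.single j α)),
    ofValues_mem_DualHom₀ (pi_single_eq_zero x j h α) (pi_single_finite x j α)⟩

open Classical in
theorem singleHom_gen {p : ℤ} {x : Simplex K} {j : ℤ} (h : dim K x = j + p) (g : G.X j)
    (y : Simplex K) (i : ℤ) : (singleHom p x j h g).1 (dim K y) i (gen K y) =
      (Pi.single x (Pi.single j g) : Simplex K → ∀ j, G.X j) y i :=
  ofValues_gen (M := fun j => G.X j) _ _ _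

open Classical in
theorem singleDualHom_gen {p : ℤ} {x : Simplex K} {j : ℤ} (h : dim K x = j + p) (α : Dual G j)
    (y : Simplex K) (i : ℤ) : (singleDualHom p x j h α).1 (dim K y) i (gen K y) =
      (Pi.single x (Pi.single j α) : Simplex K → ∀ j, Dual G j) y i :=
  ofValues_gen _ _ _

/-- Makes every shift of configurations a P_t, as needed to expand local operators in Weyl
monomials. -/
theorem toConf_surjective : Function.Surjective (toConf : Hom₀ K G 0 → Conf K G) := by
  intro c
  refine ⟨⟨ofValues fun x => Pi.single (dim K x) (c.1 x), ofValues_mem_Hom₀ ?_ ?_⟩, ?_⟩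
  · intro x j h
    exact Pi.single_eq_of_ne (by omega) _
  · refine c.2.subset ?_
    rintro x ⟨j, hj⟩ hx
    exact hj (by simp [hx])
  · refine Subtype.ext (funext fun x => ?_)
    simp [toConf]

/-- Two families that agree on all simplices are equal. -/
theorem family_ext {M : ℤ → Type w} [∀ j, AddCommGroup (M j)] {s t : ∀ n j : ℤ, Chain K n →+ M j}
    (h : ∀ x j, s (dim K x) j (gen K x) = t (dim K x) j (gen K x)) : s = t := by
  funext n j
  refine Finsupp.addHom_ext' fun y => AddMonoidHom.ext_int ?_
  obtain ⟨y, rfl⟩ := y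
  exact h y j

/-- Replaces the support of c by a fixed finite Λ, so that later double products over Λ can be
interchanged. Terms in only one of the two index sets vanish, through τ outside Λ and through ε
outside the support. -/
theorem hom_chain_eq_sum {A : Type*} [AddCommGroup A] (τ : ∀ n : ℤ, Chain K n →+ A)
    {Λ : Finset (Simplex K)} (hΛ : ∀ x, x ∉ Λ → τ (dim K x) (gen K x) = 0) {m : ℤ}
    (c : Chain K m) (ε : Simplex K → ℤ) (hc : ∀ y, c y = ε y.1)
    (hε : ∀ y, dim K y ≠ m → ε y = 0) :
    τ m c = ∑ y ∈ Λ, ε y • τ (dim K y) (gen K y) := by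
  classical
  have h1 : c = ∑ y ∈ c.support, c y • Finsupp.single y (1 : ℤ) := by
    conv_lhs => rw [← Finsupp.sum_single c, Finsupp.sum]
    simp
  have h2 : ∀ y : SimplexOfDim K m, τ m (Finsupp.single y 1) = τ (dim K y.1) (gen K y.1) := by
    rintro ⟨y, rfl⟩
    rfl
  conv_lhs => rw [h1, map_sum]
  have h3 : ∑ y ∈ c.support, τ m (c y • Finsupp.single y (1 : ℤ)) =
      ∑ y ∈ c.support.map (Function.Embedding.subtype _), ε y • τ (dim K y) (gen K y) := by
    rw [Finset.sum_map]
    refine Finset.sum_congr rfl fun y _ => ?_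
    rw [map_zsmul, h2, hc]
    rfl
  rw [h3]
  refine Finset.sum_congr_of_eq_on_inter ?_ ?_ fun _ _ _ => rfl
  · intro y _ hy
    rw [hΛ y hy, zsmul_zero]
  · intro y _ hy
    by_cases hd : dim K y = m
    · by_cases h0 : ε y = 0
      · rw [h0, zero_zsmul]
      · refine absurd ?_ hy
        rw [Finset.mem_map]
        exact ⟨⟨y, hd⟩, by rw [Finsupp.mem_support_iff, hc]; exact h0, rfl⟩
    · rw [hε y hd, zero_zsmul]

theorem dim_eq_of_incidence_ne_zero {x y : Simplex K} (h : incidence K x y ≠ 0) :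
    dim K x = dim K y + 1 := by
  have := (incidence_ne_zero K h).2
  simp only [dim]
  omega

end Values

/-! ### Adjointness of δ^p and δ_{p+1}, and the phases it determines -/

section Adjoint

variable {V : Type u} [LinearOrder V] {N L : ℕ} {K : OrientedComplex V N L}
  {G : ChainComplex AddCommGrpCat.{w} ℤ}

theorem Family.boundary_gen {t : Family K G} {Λ : Finset (Simplex K)} (hΛ : t.support ⊆ Λ)
    (x : Simplex K) (j : ℤ) :
    t (dim K x - 1) j (boundary K (dim K x) (dim K x - 1) (gen K x)) =
      ∑ y ∈ Λ, incidence K x y • t (dim K y) j (gen K y) := by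
  refine hom_chain_eq_sum (fun n => t n j) (fun y hy => ?_) _ _ (boundary_gen_apply x _)
    fun y hy => ?_
  · by_contra h
    exact hy (hΛ ⟨j, h⟩)
  · by_contra h
    have := dim_eq_of_incidence_ne_zero h
    omega

theorem DualFamily.coboundary_gen {γ : DualFamily K G} {Λ : Finset (Simplex K)}
    (hΛ : γ.support ⊆ Λ) (y : Simplex K) (j : ℤ) :
    γ (dim K y + 1) j (coboundary K (dim K y) (dim K y + 1) (gen K y)) =
      ∑ x ∈ Λ, incidence K x y • γ (dim K x) j (gen K x) := by
  refine hom_chain_eq_sum (fun n => γ n j) (fun x hx => ?_) _ _ (coboundary_gen_apply y _)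
    fun x hx => ?_
  · by_contra h
    exact hx (hΛ ⟨j, h⟩)
  · by_contra h
    have := dim_eq_of_incidence_ne_zero h
    omega

theorem addChar_sum_apply {A M ι : Type*} [AddCommGroup A] [CommGroup M] (s : Finset ι)
    (ψ : ι → AddChar A M) (a : A) : (∑ i ∈ s, ψ i) a = ∏ i ∈ s, ψ i a := by
  classical
  induction s using Finset.induction_on with
  | empty => simp
  | insert i s hi ih => rw [Finset.sum_insert hi, Finset.prod_insert hi, AddChar.add_apply, ih]

theorem addChar_map_sum {A M ι : Type*} [AddCommGroup A] [CommGroup M] (s : Finset ι)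
    (ψ : AddChar A M) (a : ι → A) : ψ (∑ i ∈ s, a i) = ∏ i ∈ s, ψ (a i) := by
  classical
  induction s using Finset.induction_on with
  | empty => simp
  | insert i s hi ih =>
    rw [Finset.sum_insert hi, Finset.prod_insert hi, AddChar.map_add_eq_mul, ih]

/-- The maps `δ^p` and `δ_{p+1}` are adjoint to each other. -/
theorem prod_δFam_eq_prod_δDualFam (p : ℤ) (t : Family K G) (γ : DualFamily K G)
    {Λ : Finset (Simplex K)} (ht : t.support ⊆ Λ) (hγ : γ.support ⊆ Λ) (k l : ℤ → ℤ)
    (hl : ∀ n, l n = n - p) (hk : ∀ n, k n = n - (p + 1)) :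
    ∏ x ∈ Λ, γ (dim K x) (k (dim K x)) (gen K x)
        (δFam K G p t (dim K x) (k (dim K x)) (gen K x)) =
      ∏ x ∈ Λ, δDualFam K G (p + 1) γ (dim K x) (l (dim K x)) (gen K x)
        (t (dim K x) (l (dim K x)) (gen K x)) := by
  -- The degrees are functions `k`, `l` known only up to equations, so that the two later uses match
  -- their goals definitionally, without transport between the groups G_j.
  have h1 : ∀ x, γ (dim K x) (k (dim K x)) (gen K x)
        (δFam K G p t (dim K x) (k (dim K x)) (gen K x)) =
      (∏ y ∈ Λ, γ (dim K x) (k (dim K x)) (gen K x) (t (dim K y) (k (dim K x)) (gen K y)) ^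
        incidence K x y) *
      (γ (dim K x) (k (dim K x)) (gen K x) (bdG G (k (dim K x) + 1) (k (dim K x))
        (t (dim K x) (k (dim K x) + 1) (gen K x))) ^ (p.negOnePow : ℤ))⁻¹ := by
    intro x
    have : δFam K G p t (dim K x) (k (dim K x)) (gen K x) =
      t (dim K x - 1) (k (dim K x)) (boundary K (dim K x) (dim K x - 1) (gen K x)) -
      (p.negOnePow : ℤ) • bdG G (k (dim K x) + 1) (k (dim K x))
        (t (dim K x) (k (dim K x) + 1) (gen K x)) := rfl
    rw [this, Family.boundary_gen ht, AddChar.map_sub_eq_div, addChar_map_sum,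
      div_eq_mul_inv, AddChar.map_zsmul_eq_zpow]
    simp only [AddChar.map_zsmul_eq_zpow]
  have h2 : ∀ y, δDualFam K G (p + 1) γ (dim K y) (l (dim K y)) (gen K y)
        (t (dim K y) (l (dim K y)) (gen K y)) =
      (∏ x ∈ Λ, γ (dim K x) (l (dim K y)) (gen K x) (t (dim K y) (l (dim K y)) (gen K y)) ^
        incidence K x y) *
      (γ (dim K y) (l (dim K y) - 1) (gen K y) (bdG G (l (dim K y)) (l (dim K y) - 1)
        (t (dim K y) (l (dim K y)) (gen K y))) ^ (p.negOnePow : ℤ))⁻¹ := by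
    intro y
    have : δDualFam K G (p + 1) γ (dim K y) (l (dim K y)) (gen K y) =
      γ (dim K y + 1) (l (dim K y)) (coboundary K (dim K y) (dim K y + 1) (gen K y)) -
      ((p + 1 - 1).negOnePow : ℤ) • dualBdG G (l (dim K y)) (l (dim K y) - 1)
        (γ (dim K y) (l (dim K y) - 1) (gen K y)) := rfl
    -- The sign (-1)^((p+1)-1) of δ_{p+1} becomes the sign (-1)^p of δ^p.
    rw [this, DualFamily.coboundary_gen hγ, add_sub_cancel_right, AddChar.sub_apply',
      addChar_sum_apply, div_eq_mul_inv, AddChar.zsmul_apply]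
    simp only [AddChar.zsmul_apply]
    rfl
  simp only [h1, h2]
  rw [Finset.prod_mul_distrib, Finset.prod_mul_distrib]
  congr 1
  -- The degrees of the two sides agree only where dim x = dim y + 1; elsewhere the exponent ε_{x,y}
  -- is 0.
  · rw [Finset.prod_comm]
    refine Finset.prod_congr rfl fun y _ => Finset.prod_congr rfl fun x _ => ?_
    by_cases h : incidence K x y = 0
    · rw [h, zpow_zero, zpow_zero]
    · have hd := dim_eq_of_incidence_ne_zero h
      have : k (dim K x) = l (dim K y) := by rw [hk, hl]; omega
      rw [this]
  · refine Finset.prod_congr rfl fun x _ => ?_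
    have hkl : k (dim K x) + 1 = l (dim K x) := by rw [hk, hl]; omega
    have hlk : l (dim K x) - 1 = k (dim K x) := by omega
    rw [hkl, hlk]

variable (γ : DualHom₀ K G 0)

/-- The condition outside Λ concerns values rather than the support of γ, so that either γ or c may
be what vanishes there. -/
theorem pairing_eq_prod {Λ : Finset (Simplex K)} (c : Conf K G)
    (h : ∀ x, x ∉ Λ → γ.1 (dim K x) (dim K x) (gen K x) (c.1 x) = 1) :
    pairing γ c = ∏ x ∈ Λ, γ.1 (dim K x) (dim K x) (gen K x) (c.1 x) := by
  refine finprod_eq_prod_of_mulSupport_subset _ fun x hx => ?_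
  by_contra hn
  exact hx (h x hn)

theorem pairing_eq_prod_of_support_subset {Λ : Finset (Simplex K)}
    (h : DualFamily.support γ.1 ⊆ Λ) (c : Conf K G) :
    pairing γ c = ∏ x ∈ Λ, γ.1 (dim K x) (dim K x) (gen K x) (c.1 x) := by
  refine pairing_eq_prod γ c fun x hx => ?_
  have : γ.1 (dim K x) (dim K x) (gen K x) = 0 := by
    by_contra h0
    exact hx (h ⟨_, h0⟩)
  rw [this, AddChar.zero_apply]

theorem pairing_add (c d : Conf K G) : pairing γ (c + d) = pairing γ c * pairing γ d := by
  have h : DualFamily.support γ.1 ⊆ (γ.2.2.toFinset : Set (Simplex K)) := by simp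
  simp only [pairing_eq_prod_of_support_subset γ h, ← Finset.prod_mul_distrib]
  exact Finset.prod_congr rfl fun x _ => AddChar.map_add_eq_mul _ _ _

theorem pairing_add_left (γ γ' : DualHom₀ K G 0) (c : Conf K G) :
    pairing (γ + γ') c = pairing γ c * pairing γ' c := by
  classical
  have h : ∀ η ∈ ({γ, γ', γ + γ'} : Finset (DualHom₀ K G 0)), DualFamily.support η.1 ⊆
    ((({γ, γ', γ + γ'} : Finset (DualHom₀ K G 0)).biUnion fun η => η.2.2.toFinset :
      Finset (Simplex K)) : Set (Simplex K)) := by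
    intro η hη x hx
    simp only [Finset.mem_coe, Finset.mem_biUnion]
    exact ⟨η, hη, by simpa using hx⟩
  rw [pairing_eq_prod_of_support_subset _ (h γ (by simp)),
    pairing_eq_prod_of_support_subset _ (h γ' (by simp)),
    pairing_eq_prod_of_support_subset _ (h (γ + γ') (by simp)), ← Finset.prod_mul_distrib]
  rfl

theorem toConf_add (s t : Hom₀ K G 0) : toConf (s + t) = toConf s + toConf t := rfl

/-- `γ(δ^{-1} s)` in terms of `δ_0 γ`. -/
theorem pairing_δUp (s : Hom₀ K G (-1)) {Λ : Finset (Simplex K)}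
    (hs : Family.support s.1 ⊆ Λ) (hγ : DualFamily.support γ.1 ⊆ Λ) :
    pairing γ (toConf (δUp K G (-1) 0 (by norm_num) s)) =
      ∏ x ∈ Λ, δDualFam K G 0 γ.1 (dim K x) (dim K x + 1) (gen K x)
        (s.1 (dim K x) (dim K x + 1) (gen K x)) := by
  rw [pairing_eq_prod_of_support_subset γ hγ]
  exact prod_δFam_eq_prod_δDualFam (-1) s.1 γ.1 hs hγ (fun n => n) (fun n => n + 1)
    (fun n => by ring) fun n => by ring

/-- `(δ_1 γ)(t)` in terms of `δ^0 t`. -/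
theorem pairing_δDown (γ : DualHom₀ K G 1) (t : Hom₀ K G 0) {Λ : Finset (Simplex K)}
    (ht : Family.support t.1 ⊆ Λ) (hγ : DualFamily.support γ.1 ⊆ Λ) :
    pairing (δDown K G 1 0 (by norm_num) γ) (toConf t) =
      ∏ x ∈ Λ, γ.1 (dim K x) (dim K x - 1) (gen K x)
        (δFam K G 0 t.1 (dim K x) (dim K x - 1) (gen K x)) := by
  rw [pairing_eq_prod (Λ := Λ)]
  · exact (prod_δFam_eq_prod_δDualFam 0 t.1 γ.1 ht hγ (fun n => n - 1) (fun n => n)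
      (fun n => by ring) fun n => by ring).symm
  -- The support of δ_1γ may leave Λ, but t vanishes outside Λ.
  · intro x hx
    have : (toConf t).1 x = 0 := by
      by_contra h0
      exact hx (ht ⟨_, h0⟩)
    rw [this, AddChar.map_zero_eq_one]

theorem pairing_δUp_eq_one {γ : DualHom₀ K G 0} (hγ : γ ∈ (δDown K G 0 (-1) (by norm_num)).ker)
    (s : Hom₀ K G (-1)) : pairing γ (toConf (δUp K G (-1) 0 (by norm_num) s)) = 1 := by
  have h : δDualFam K G 0 γ.1 = 0 := congrArg Subtype.val (AddMonoidHom.mem_ker.1 hγ)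
  classical
  rw [pairing_δUp γ s (Λ := s.2.2.toFinset ∪ γ.2.2.toFinset) (by simp) (by simp), h]
  exact Finset.prod_eq_one fun x _ => rfl

theorem pairing_δDown_eq_one {t : Hom₀ K G 0} (ht : t ∈ (δUp K G 0 1 (by norm_num)).ker)
    (γ : DualHom₀ K G 1) : pairing (δDown K G 1 0 (by norm_num) γ) (toConf t) = 1 := by
  have h : δFam K G 0 t.1 = 0 := congrArg Subtype.val (AddMonoidHom.mem_ker.1 ht)
  classical
  rw [pairing_δDown γ t (Λ := t.2.2.toFinset ∪ γ.2.2.toFinset) (by simp) (by simp), h]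
  exact Finset.prod_eq_one fun x _ => AddChar.map_zero_eq_one _

variable [∀ j, Finite (G.X j)]

theorem addChar_pow_card {A M : Type*} [AddGroup A] [Finite A] [Monoid M] (ψ : AddChar A M)
    (a : A) : ψ a ^ Nat.card A = 1 := by
  rw [← AddChar.map_nsmul_eq_pow, card_nsmul_eq_zero', AddChar.map_zero_eq_one]

/-- Pick a simplex x and g with (δ_0γ)(x)[g] ≠ 1, and let s have the value g at x and 0 elsewhere.
By adjointness the phase is this one character value, whose order divides the order of the finite
group. -/
theorem exists_pairing_δUp_ne_one {γ : DualHom₀ K G 0}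
    (hγ : γ ∉ (δDown K G 0 (-1) (by norm_num)).ker) :
    ∃ (s : Hom₀ K G (-1)) (m : ℕ), 0 < m ∧
      pairing γ (toConf (δUp K G (-1) 0 (by norm_num) s)) ≠ 1 ∧
      pairing γ (toConf (δUp K G (-1) 0 (by norm_num) s)) ^ m = 1 := by
  classical
  obtain ⟨x, j, hj⟩ : ∃ x j, δDualFam K G 0 γ.1 (dim K x) j (gen K x) ≠ 0 := by
    by_contra! h
    exact hγ (Subtype.ext (family_ext h))
  -- δ_0γ is a dual (-1)-map, so only this degree can be nonzero.
  have hd : dim K x + 1 = j := by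
    by_contra hd
    refine hj ?_
    rw [(δDualFam_mem (q := -1) (by norm_num) γ.2).1 _ _ (by omega), AddMonoidHom.zero_apply]
  subst hd
  obtain ⟨g, hg⟩ := (AddChar.ne_zero_iff).1 hj
  let s : Hom₀ K G (-1) := singleHom (-1) x (dim K x + 1) (by ring) g
  have key : pairing γ (toConf (δUp K G (-1) 0 (by norm_num) s)) =
      δDualFam K G 0 γ.1 (dim K x) (dim K x + 1) (gen K x) g := by
    rw [pairing_δUp γ s (Λ := insert x (s.2.2.toFinset ∪ γ.2.2.toFinset))
      (by intro y hy; simp [hy]) (by intro y hy; simp [hy]), Finset.prod_eq_single x]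
    · simp only [s, singleHom_gen, Pi.single_eq_same]
    · intro y _ hy
      simp only [s, singleHom_gen, Pi.single_eq_of_ne hy, Pi.zero_apply, AddChar.map_zero_eq_one]
    · simp
  refine ⟨s, Nat.card (G.X (dim K x + 1)), Nat.card_pos, ?_, ?_⟩
  · rwa [key]
  · rw [key, addChar_pow_card]

theorem exists_addChar_ne_one {A : Type*} [AddCommGroup A] [Finite A] {a : A} (ha : a ≠ 0) :
    ∃ ψ : AddChar A Circle, ψ a ≠ 1 := by
  obtain ⟨ψ, hψ⟩ := AddChar.exists_apply_ne_zero.2 ha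
  refine ⟨AddChar.circleEquivComplex.symm ψ, fun h => hψ ?_⟩
  rw [← AddChar.circleEquivComplex.apply_symm_apply ψ]
  exact congrArg (fun z : Circle => (z : ℂ)) h

/-- Dual argument: choose a character α nontrivial on a nonzero value of δ^0t at x, and concentrate
γ = α at x. -/
theorem exists_pairing_δDown_ne_one {t : Hom₀ K G 0}
    (ht : t ∉ (δUp K G 0 1 (by norm_num)).ker) :
    ∃ (γ : DualHom₀ K G 1) (m : ℕ), 0 < m ∧
      pairing (δDown K G 1 0 (by norm_num) γ) (toConf t) ≠ 1 ∧
      pairing (δDown K G 1 0 (by norm_num) γ) (toConf t) ^ m = 1 := by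
  classical
  obtain ⟨x, j, hj⟩ : ∃ x j, δFam K G 0 t.1 (dim K x) j (gen K x) ≠ 0 := by
    by_contra! h
    exact ht (Subtype.ext (family_ext h))
  have hd : dim K x - 1 = j := by
    by_contra hd
    refine hj ?_
    rw [(δFam_mem (q := 1) (by norm_num) t.2).1 _ _ (by omega), AddMonoidHom.zero_apply]
  subst hd
  obtain ⟨α, hα⟩ := exists_addChar_ne_one hj
  let γ : DualHom₀ K G 1 := singleDualHom 1 x (dim K x - 1) (by ring) α
  have key : pairing (δDown K G 1 0 (by norm_num) γ) (toConf t) =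
      α (δFam K G 0 t.1 (dim K x) (dim K x - 1) (gen K x)) := by
    rw [pairing_δDown γ t (Λ := insert x (t.2.2.toFinset ∪ γ.2.2.toFinset))
      (by intro y hy; simp [hy]) (by intro y hy; simp [hy]), Finset.prod_eq_single x]
    · simp only [γ, singleDualHom_gen, Pi.single_eq_same]
    · intro y _ hy
      simp only [γ, singleDualHom_gen, Pi.single_eq_of_ne hy, Pi.zero_apply, AddChar.zero_apply]
    · simp
  refine ⟨γ, Nat.card (G.X (dim K x - 1)), Nat.card_pos, ?_, ?_⟩
  · rwa [key]
  · rw [key, addChar_pow_card]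

end Adjoint

/-! ### Averaging over conjugations -/

section Average

variable {𝒜 : Type*} [NormedRing 𝒜]

/-- Induction on the whole product, since the norm of U^0 = 1 need not be at most 1 in a general
normed ring. -/
theorem norm_pow_mul_pow_le {U V : 𝒜} (hU : ‖U‖ ≤ 1) (hV : ‖V‖ ≤ 1) (X : 𝒜) (k : ℕ) :
    ‖U ^ k * X * V ^ k‖ ≤ ‖X‖ := by
  induction k with
  | zero => simp
  | succ k ih =>
    have : U ^ (k + 1) * X * V ^ (k + 1) = U * (U ^ k * X * V ^ k) * V := by
      rw [pow_succ', pow_succ]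
      noncomm_ring
    rw [this]
    calc _ ≤ ‖U‖ * ‖U ^ k * X * V ^ k‖ * ‖V‖ :=
          (norm_mul_le _ _).trans (mul_le_mul_of_nonneg_right (norm_mul_le _ _) (norm_nonneg _))
      _ ≤ 1 * ‖U ^ k * X * V ^ k‖ * 1 := by gcongr
      _ ≤ ‖X‖ := by simpa using ih

variable [NormedAlgebra ℂ 𝒜]

/-- The average of `X` over the conjugations by the first `m` powers of `U`, where `V = U⁻¹`. -/
noncomputable def average (U V : 𝒜) (m : ℕ) : 𝒜 →ₗ[ℂ] 𝒜 :=
  (m : ℂ)⁻¹ • ∑ k ∈ Finset.range m, LinearMap.mulLeftRight ℂ (U ^ k, V ^ k)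

theorem average_apply (U V : 𝒜) (m : ℕ) (X : 𝒜) :
    average U V m X = (m : ℂ)⁻¹ • ∑ k ∈ Finset.range m, U ^ k * X * V ^ k := by
  simp [average]

theorem norm_average_le {U V : 𝒜} (hU : ‖U‖ ≤ 1) (hV : ‖V‖ ≤ 1) {m : ℕ} (hm : 0 < m) (X : 𝒜) :
    ‖average U V m X‖ ≤ ‖X‖ := by
  have hm' : (0 : ℝ) < m := by exact_mod_cast hm
  rw [average_apply, norm_smul, norm_inv, Complex.norm_natCast, inv_mul_le_iff₀ hm']
  refine (norm_sum_le_of_le _ fun k _ => norm_pow_mul_pow_le hU hV X k).trans ?_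
  simp

/-- W is an eigenvector of each conjugation, U^k W V^k = χ^k W, so averaging multiplies it by the
mean of the χ^k. -/
theorem average_of_semiconj {U V W : 𝒜} {χ : ℂ} (hUV : U * V = 1) (h : U * W = χ • (W * U))
    (m : ℕ) : average U V m W = ((m : ℂ)⁻¹ * ∑ k ∈ Finset.range m, χ ^ k) • W := by
  have key : ∀ k : ℕ, U ^ k * W * V ^ k = χ ^ k • W := by
    intro k
    induction k with
    | zero => simp
    | succ k ih =>
      have : U ^ (k + 1) * W * V ^ (k + 1) = U * (U ^ k * W * V ^ k) * V := by
        rw [pow_succ', pow_succ]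
        noncomm_ring
      rw [this, ih, mul_smul_comm, h, smul_mul_assoc, smul_mul_assoc, mul_assoc, hUV, mul_one,
        smul_smul, pow_succ]
  rw [average_apply, Finset.sum_congr rfl fun k _ => key k, ← Finset.sum_smul, smul_smul]

theorem average_of_commute {U V W : 𝒜} (hUV : U * V = 1) (h : U * W = W * U) {m : ℕ}
    (hm : 0 < m) : average U V m W = W := by
  rw [average_of_semiconj (χ := 1) hUV (by rw [h, one_smul])]
  have : (m : ℂ) ≠ 0 := by exact_mod_cast hm.ne'
  simp [this]

theorem average_eq_zero {U V W : 𝒜} {χ : ℂ} (hUV : U * V = 1) (h : U * W = χ • (W * U))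
    {m : ℕ} (hχ : χ ≠ 1) (hm : χ ^ m = 1) : average U V m W = 0 := by
  rw [average_of_semiconj hUV h, geom_sum_eq hχ, hm]
  simp

/-- If every element of `S` is either in `S₀`, whose elements commute with the unitaries in `𝒰`,
or is multiplied by a nontrivial root of unity under conjugation by some element of `𝒰`, then an
element of the commutant of `𝒰` is approximated by the span of `S₀` as well as by that of `S`. -/
theorem exists_mem_span_norm_sub_le {𝒰 S S₀ : Set 𝒜}
    (h𝒰 : ∀ U ∈ 𝒰, ‖U‖ ≤ 1 ∧ ∃ V, ‖V‖ ≤ 1 ∧ U * V = 1)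
    (hS : ∀ U ∈ 𝒰, ∀ W ∈ S, ∃ χ : ℂ, U * W = χ • (W * U))
    (hS₀ : ∀ U ∈ 𝒰, ∀ W ∈ S₀, U * W = W * U)
    (hbad : ∀ W ∈ S, W ∉ S₀ → ∃ U ∈ 𝒰, ∃ (χ : ℂ) (m : ℕ), 0 < m ∧ χ ≠ 1 ∧ χ ^ m = 1 ∧
      U * W = χ • (W * U))
    {T : 𝒜} (hT : ∀ U ∈ 𝒰, U * T = T * U) {T₀ : 𝒜} (hT₀ : T₀ ∈ Submodule.span ℂ S) :
    ∃ T₁ ∈ Submodule.span ℂ S₀, ‖T - T₁‖ ≤ ‖T - T₀‖ := by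
  classical
  -- Induction on the finite set F of monomials still allowed besides S₀; each bad one costs one
  -- average.
  have step : ∀ F : Finset 𝒜, (F : Set 𝒜) ⊆ S → ∀ T₀ ∈ Submodule.span ℂ (S₀ ∪ F),
      ∃ T₁ ∈ Submodule.span ℂ S₀, ‖T - T₁‖ ≤ ‖T - T₀‖ := by
    intro F
    induction F using Finset.induction_on with
    | empty =>
      intro _ T₀ hT₀
      exact ⟨T₀, by simpa using hT₀, le_rfl⟩
    | insert W F _ ih =>
      intro hF T₀ hT₀
      rw [Finset.coe_insert, Set.insert_subset_iff] at hF
      by_cases hW : W ∈ S₀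
      · refine ih hF.2 T₀ ?_
        rwa [Finset.coe_insert, Set.union_insert, Set.insert_eq_of_mem (Set.mem_union_left _ hW)] at hT₀
      · obtain ⟨U, hU, χ, m, hm, hχ, hχm, hUW⟩ := hbad W hF.1 hW
        obtain ⟨hU1, V, hV1, hUV⟩ := h𝒰 U hU
        -- W is killed, S₀ is fixed and the rest of F is only rescaled, so earlier eliminations are
        -- not undone.
        have hmem : average U V m T₀ ∈ Submodule.span ℂ (S₀ ∪ F) := by
          induction hT₀ using Submodule.span_induction with
          | mem X hX =>
            rw [Finset.coe_insert] at hX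
            rcases hX with hX | rfl | hX
            · rw [average_of_commute hUV (hS₀ U hU X hX) hm]
              exact Submodule.subset_span (Or.inl hX)
            · rw [average_eq_zero hUV hUW hχ hχm]
              exact zero_mem _
            · obtain ⟨χ', h'⟩ := hS U hU X (hF.2 hX)
              rw [average_of_semiconj hUV h']
              exact Submodule.smul_mem _ _ (Submodule.subset_span (Or.inr hX))
          | zero => rw [map_zero]; exact zero_mem _
          | add X Y _ _ hX hY => rw [map_add]; exact add_mem hX hY
          | smul a X _ hX => rw [map_smul]; exact Submodule.smul_mem _ _ hX
        obtain ⟨T₁, h₁, hle⟩ := ih hF.2 _ hmem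
        refine ⟨T₁, h₁, hle.trans ?_⟩
        have : T - average U V m T₀ = average U V m (T - T₀) := by
          rw [map_sub, average_of_commute hUV (hT U hU) hm]
        rw [this]
        exact norm_average_le hU1 hV1 hm _
  obtain ⟨F, hF, hT₀F⟩ := Submodule.mem_span_finite_of_mem_span hT₀
  exact step F hF T₀ (Submodule.span_mono Set.subset_union_right hT₀F)

end Average

/-! ### Weyl relations and the generators of the core algebra -/

section Weyl

variable {V : Type u} [LinearOrder V] {N L : ℕ} {K : OrientedComplex V N L}
  {G : ChainComplex AddCommGrpCat.{w} ℤ}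

theorem norm_ofOrthonormal_le (v : Conf K G → H K G) (hv : Orthonormal ℂ v) :
    ‖ofOrthonormal v hv‖ ≤ 1 :=
  LinearIsometry.norm_toContinuousLinearMap_le _

@[simp] theorem P_ket (t : Hom₀ K G 0) (c : Conf K G) : P t (ket c) = ket (toConf t + c) :=
  shift_ket _ _

@[simp] theorem Q_ket (γ : DualHom₀ K G 0) (c : Conf K G) :
    Q γ (ket c) = (pairing γ c : ℂ) • ket c :=
  clock_ket _ _

theorem pairing_zero_left (c : Conf K G) : pairing (0 : DualHom₀ K G 0) c = 1 := by
  have := pairing_add_left 0 0 c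
  rwa [add_zero, left_eq_mul] at this

theorem P_add (s t : Hom₀ K G 0) : P (s + t) = P s * P t :=
  ext_ket fun c => by
    rw [mul_apply_eq_comp, P_ket, P_ket, P_ket, toConf_add, add_assoc]

theorem P_zero : P (0 : Hom₀ K G 0) = 1 :=
  ext_ket fun c => by
    rw [P_ket, show toConf (0 : Hom₀ K G 0) = 0 from rfl, zero_add, one_apply_eq_self]

theorem Q_add (γ γ' : DualHom₀ K G 0) : Q (γ + γ') = Q γ * Q γ' :=
  ext_ket fun c => by
    rw [mul_apply_eq_comp, Q_ket γ', map_smul, Q_ket γ, Q_ket, pairing_add_left, smul_smul,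
      Circle.coe_mul, mul_comm]

theorem Q_zero : Q (0 : DualHom₀ K G 0) = 1 :=
  ext_ket fun c => by
    rw [Q_ket, pairing_zero_left, Circle.coe_one, one_smul, one_apply_eq_self]

theorem P_mul_P_neg (t : Hom₀ K G 0) : P t * P (-t) = 1 := by
  rw [← P_add, add_neg_cancel, P_zero]

theorem Q_mul_Q_neg (γ : DualHom₀ K G 0) : Q γ * Q (-γ) = 1 := by
  rw [← Q_add, add_neg_cancel, Q_zero]

theorem star_ofOrthonormal_mul (v : Conf K G → H K G) (hv : Orthonormal ℂ v) :
    star (ofOrthonormal v hv) * ofOrthonormal v hv = 1 :=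
  (ContinuousLinearMap.norm_map_iff_adjoint_comp_self _).1
    hv.orthogonalFamily.linearIsometry.norm_map

theorem star_P_mul_P (t : Hom₀ K G 0) : star (P t) * P t = 1 := by
  unfold P shift
  exact star_ofOrthonormal_mul _ _

theorem star_Q_mul_Q (γ : DualHom₀ K G 0) : star (Q γ) * Q γ = 1 := by
  unfold Q clock
  exact star_ofOrthonormal_mul _ _

theorem norm_P_le (t : Hom₀ K G 0) : ‖P t‖ ≤ 1 := by
  unfold P shift
  exact norm_ofOrthonormal_le _ _

theorem norm_Q_le (γ : DualHom₀ K G 0) : ‖Q γ‖ ≤ 1 := by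
  unfold Q clock
  exact norm_ofOrthonormal_le _ _

/-- P_t is an isometry, so its adjoint is a left inverse; P_{-t} is a right inverse, and the two
coincide. -/
theorem star_P (t : Hom₀ K G 0) : star (P t) = P (-t) :=
  left_inv_eq_right_inv (star_P_mul_P t) (P_mul_P_neg t)

theorem star_Q (γ : DualHom₀ K G 0) : star (Q γ) = Q (-γ) :=
  left_inv_eq_right_inv (star_Q_mul_Q γ) (Q_mul_Q_neg γ)

theorem star_A (s : Hom₀ K G (-1)) : star (A s) = A (-s) := by
  rw [A, A, star_P, map_neg]

theorem star_B (γ : DualHom₀ K G 1) : star (B γ) = B (-γ) := by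
  rw [B, B, star_Q, map_neg]

theorem Q_mul_P (t : Hom₀ K G 0) (γ : DualHom₀ K G 0) :
    Q γ * P t = (pairing γ (toConf t) : ℂ) • (P t * Q γ) :=
  ext_ket fun c => by
    rw [smul_apply, mul_apply_eq_comp, mul_apply_eq_comp, P_ket, Q_ket, Q_ket, map_smul, P_ket,
      pairing_add, Circle.coe_mul, smul_smul]

theorem P_mul_Q (t : Hom₀ K G 0) (γ : DualHom₀ K G 0) :
    P t * Q γ = (pairing γ (toConf t) : ℂ)⁻¹ • (Q γ * P t) := by
  rw [Q_mul_P, smul_smul, inv_mul_cancel₀ (Circle.coe_ne_zero _), one_smul]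

theorem P_mul_P_comm (s t : Hom₀ K G 0) : P s * P t = P t * P s := by
  rw [← P_add, add_comm, P_add]

theorem Q_mul_Q_comm (γ η : DualHom₀ K G 0) : Q γ * Q η = Q η * Q γ := by
  rw [← Q_add, add_comm, Q_add]

theorem P_mul_weyl (s t : Hom₀ K G 0) (γ : DualHom₀ K G 0) :
    P s * (P t * Q γ) = (pairing γ (toConf s) : ℂ)⁻¹ • (P t * Q γ * P s) := by
  rw [← mul_assoc, P_mul_P_comm, mul_assoc, P_mul_Q, mul_smul_comm, mul_assoc]

theorem Q_mul_weyl (η : DualHom₀ K G 0) (t : Hom₀ K G 0) (γ : DualHom₀ K G 0) :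
    Q η * (P t * Q γ) = (pairing η (toConf t) : ℂ) • (P t * Q γ * Q η) := by
  rw [← mul_assoc, Q_mul_P, smul_mul_assoc, mul_assoc, mul_assoc, Q_mul_Q_comm]

theorem A_mul_of_mem_units {W : H K G →L[ℂ] H K G} (hW : W ∈ units K G) (s : Hom₀ K G (-1)) :
    A s * W = W * A s := by
  obtain ⟨t, _, γ, hγ, rfl⟩ := hW
  rw [A, P_mul_weyl, pairing_δUp_eq_one hγ, Circle.coe_one, inv_one, one_smul]

theorem B_mul_of_mem_units {W : H K G →L[ℂ] H K G} (hW : W ∈ units K G) (η : DualHom₀ K G 1) :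
    B η * W = W * B η := by
  obtain ⟨t, ht, γ, _, rfl⟩ := hW
  rw [B, Q_mul_weyl, pairing_δDown_eq_one ht, Circle.coe_one, one_smul]

variable (K G)

/-- The set of all Weyl monomials. -/
def weylMonomials : Set (H K G →L[ℂ] H K G) := {T | ∃ t γ, T = P t * Q γ}

/-- The generators of the core algebra. -/
def coreGenerators : Set (H K G →L[ℂ] H K G) := Set.range A ∪ Set.range B

variable {K G}

theorem coreGenerators_mul_of_mem_units {U W : H K G →L[ℂ] H K G} (hU : U ∈ coreGenerators K G)
    (hW : W ∈ units K G) : U * W = W * U := by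
  rcases hU with ⟨s, rfl⟩ | ⟨η, rfl⟩
  · exact A_mul_of_mem_units hW s
  · exact B_mul_of_mem_units hW η

theorem star_mem_coreGenerators {U : H K G →L[ℂ] H K G} (hU : U ∈ coreGenerators K G) :
    star U ∈ coreGenerators K G := by
  rcases hU with ⟨s, rfl⟩ | ⟨η, rfl⟩
  · exact Or.inl ⟨-s, (star_A s).symm⟩
  · exact Or.inr ⟨-η, (star_B η).symm⟩

/-- What commutes with the generators commutes with the core algebra. -/
theorem mem_centralizer_coreAlgebra {T : H K G →L[ℂ] H K G}
    (h : ∀ U ∈ coreGenerators K G, U * T = T * U) :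
    T ∈ Set.centralizer (coreAlgebra K G : Set (H K G →L[ℂ] H K G)) := by
  -- Membership in this star subalgebra also requires commuting with T*. Taking adjoints reduces
  -- that to star U commuting with T, and star U is again a generator.
  have hgen : coreGenerators K G ⊆ StarSubalgebra.centralizer ℂ {T} := by
    intro U hU
    rw [SetLike.mem_coe, StarSubalgebra.mem_centralizer_iff]
    rintro g rfl
    refine ⟨(h U hU).symm, star_injective ?_⟩
    rw [star_mul, star_mul, star_star]
    exact h _ (star_mem_coreGenerators hU)
  have hle : StarAlgebra.adjoin ℂ (coreGenerators K G) ≤ StarSubalgebra.centralizer ℂ {T} :=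
    StarAlgebra.adjoin_le hgen
  have hclosed : IsClosed {S : H K G →L[ℂ] H K G | S * T = T * S} :=
    isClosed_eq (by fun_prop) (by fun_prop)
  intro S hS
  refine closure_minimal (fun S hS => ?_) hclosed hS
  exact ((StarSubalgebra.mem_centralizer_iff ℂ).1 (hle hS) T rfl).1.symm

theorem coreGenerators_norm_le {U : H K G →L[ℂ] H K G} (hU : U ∈ coreGenerators K G) :
    ‖U‖ ≤ 1 ∧ ∃ V : H K G →L[ℂ] H K G, ‖V‖ ≤ 1 ∧ U * V = 1 := by
  rcases hU with ⟨s, rfl⟩ | ⟨η, rfl⟩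
  · exact ⟨norm_P_le _, _, norm_P_le _, P_mul_P_neg _⟩
  · exact ⟨norm_Q_le _, _, norm_Q_le _, Q_mul_Q_neg _⟩

theorem exists_coreGenerators_mul_weyl {U W : H K G →L[ℂ] H K G} (hU : U ∈ coreGenerators K G)
    (hW : W ∈ weylMonomials K G) : ∃ χ : ℂ, U * W = χ • (W * U) := by
  obtain ⟨t, γ, rfl⟩ := hW
  rcases hU with ⟨s, rfl⟩ | ⟨η, rfl⟩
  · exact ⟨_, P_mul_weyl _ _ _⟩
  · exact ⟨_, Q_mul_weyl _ _ _⟩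

/-- If δ^0t ≠ 0, some B_η detects the monomial; otherwise δ_0γ ≠ 0 and some A_s does. -/
theorem exists_root_of_unity_of_notMem_units [∀ j, Finite (G.X j)] {W : H K G →L[ℂ] H K G}
    (hW : W ∈ weylMonomials K G) (hn : W ∉ units K G) :
    ∃ U ∈ coreGenerators K G, ∃ (χ : ℂ) (m : ℕ), 0 < m ∧ χ ≠ 1 ∧ χ ^ m = 1 ∧
      U * W = χ • (W * U) := by
  obtain ⟨t, γ, rfl⟩ := hW
  by_cases ht : t ∈ (δUp K G 0 1 (by norm_num)).ker
  · have hγ : γ ∉ (δDown K G 0 (-1) (by norm_num)).ker := fun hγ => hn ⟨t, ht, γ, hγ, rfl⟩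
    obtain ⟨s, m, hm, h1, h2⟩ := exists_pairing_δUp_ne_one hγ
    refine ⟨A s, Or.inl ⟨s, rfl⟩, _, m, hm, ?_, ?_, P_mul_weyl _ _ _⟩
    · rw [← Circle.coe_inv, Ne, Circle.coe_eq_one, inv_eq_one]
      exact h1
    · rw [← Circle.coe_inv, ← Circle.coe_pow, inv_pow, h2, inv_one, Circle.coe_one]
  · obtain ⟨η, m, hm, h1, h2⟩ := exists_pairing_δDown_ne_one ht
    refine ⟨B η, Or.inr ⟨η, rfl⟩, _, m, hm, ?_, ?_, Q_mul_weyl _ _ _⟩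
    · rwa [Ne, Circle.coe_eq_one]
    · rw [← Circle.coe_pow, h2, Circle.coe_one]

theorem mul_mem_span_range_Q {S T : H K G →L[ℂ] H K G}
    (hS : S ∈ Submodule.span ℂ (Set.range (Q (K := K) (G := G))))
    (hT : T ∈ Submodule.span ℂ (Set.range (Q (K := K) (G := G)))) :
    S * T ∈ Submodule.span ℂ (Set.range (Q (K := K) (G := G))) := by
  have := Submodule.mul_mem_mul hS hT
  rw [Submodule.span_mul_span] at this
  refine Submodule.span_mono ?_ this
  rintro _ ⟨_, ⟨γ, rfl⟩, _, ⟨η, rfl⟩, rfl⟩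
  exact ⟨γ + η, Q_add γ η⟩

theorem P_mul_mem_span_weyl (t : Hom₀ K G 0) {T : H K G →L[ℂ] H K G}
    (hT : T ∈ Submodule.span ℂ (Set.range (Q (K := K) (G := G)))) :
    P t * T ∈ Submodule.span ℂ (weylMonomials K G) := by
  induction hT using Submodule.span_induction with
  | mem X hX =>
    obtain ⟨γ, rfl⟩ := hX
    exact Submodule.subset_span ⟨t, γ, rfl⟩
  | zero => rw [mul_zero]; exact zero_mem _
  | add X Y _ _ hX hY => rw [mul_add]; exact add_mem hX hY
  | smul a X _ hX => rw [mul_smul_comm]; exact Submodule.smul_mem _ _ hX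

theorem pairing_singleDualHom (x : Simplex K) (α : Dual G (dim K x)) (c : Conf K G) :
    pairing (singleDualHom 0 x (dim K x) (by ring) α) c = α (c.1 x) := by
  classical
  rw [pairing_eq_prod (Λ := {x}), Finset.prod_singleton, singleDualHom_gen, Pi.single_eq_same,
    Pi.single_eq_same]
  intro y hy
  rw [singleDualHom_gen, Pi.single_eq_of_ne (by simpa using hy), Pi.zero_apply,
    AddChar.zero_apply]

theorem extend_res_apply {Λ : Finset (Simplex K)} {x : Simplex K} (hx : x ∈ Λ) (c : Conf K G) :
    (extend Λ (res Λ c)).1 x = c.1 x :=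
  dif_pos hx

theorem extend_res (Λ : Finset (Simplex K)) {c : Conf K G} (h : ∀ x, c.1 x ≠ 0 → x ∈ Λ) :
    extend Λ (res Λ c) = c := by
  refine Subtype.ext (funext fun x => ?_)
  by_cases hx : x ∈ Λ
  · simp [extend, res, hx]
  · have : c.1 x = 0 := by
      by_contra h0
      exact hx (h x h0)
    simp [extend, hx, this]

theorem units_subset_weylMonomials : units K G ⊆ weylMonomials K G := by
  rintro _ ⟨t, _, γ, _, rfl⟩
  exact ⟨t, γ, rfl⟩

/-! ### Local operators as combinations of Weyl monomials -/

variable [∀ j, Finite (G.X j)]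

/-- The functions `c ↦ f (c x)` act by combinations of clock operators. -/
theorem exists_mem_span_range_Q_site (x : Simplex K) (f : G.X (dim K x) → ℂ) :
    ∃ T ∈ Submodule.span ℂ (Set.range (Q (K := K) (G := G))),
      ∀ c : Conf K G, T (ket c) = f (c.1 x) • ket c := by
  have := Fintype.ofFinite (G.X (dim K x))
  -- The characters of a finite abelian group are a basis of its complex functions.
  have hf : f ∈ Submodule.span ℂ (Set.range (AddChar.complexBasis (G.X (dim K x)))) := by
    rw [Module.Basis.span_eq]
    trivial
  induction hf using Submodule.span_induction with
  | mem f hf =>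
    obtain ⟨ψ, rfl⟩ := hf
    refine ⟨_, Submodule.subset_span ⟨singleDualHom 0 x (dim K x) (by ring)
      (AddChar.circleEquivComplex.symm ψ), rfl⟩, fun c => ?_⟩
    rw [Q_ket, pairing_singleDualHom, AddChar.complexBasis_apply]
    rfl
  | zero => exact ⟨0, zero_mem _, fun c => by simp⟩
  | add f g _ _ hf hg =>
    obtain ⟨S, hS, hS'⟩ := hf
    obtain ⟨T, hT, hT'⟩ := hg
    exact ⟨S + T, add_mem hS hT, fun c => by simp [hS', hT', add_smul]⟩
  | smul a f _ hf =>
    obtain ⟨S, hS, hS'⟩ := hf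
    exact ⟨a • S, Submodule.smul_mem _ _ hS, fun c => by simp [hS', smul_smul]⟩

-- The indicator is a product of one-site indicators. Taking d as a global configuration keeps its
-- type fixed in the induction on Λ.
open Classical in
theorem exists_mem_span_range_Q_indicator (Λ : Finset (Simplex K)) (d : Conf K G) :
    ∃ T ∈ Submodule.span ℂ (Set.range (Q (K := K) (G := G))),
      ∀ c : Conf K G, T (ket c) = if ∀ x ∈ Λ, c.1 x = d.1 x then ket c else 0 := by
  induction Λ using Finset.induction_on with
  | empty =>
    exact ⟨1, Submodule.subset_span ⟨0, Q_zero⟩, fun c => by simp⟩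
  | insert x Λ _ ih =>
    obtain ⟨T, hT, hT'⟩ := ih
    obtain ⟨S, hS, hS'⟩ := exists_mem_span_range_Q_site x fun g => if g = d.1 x then 1 else 0
    refine ⟨S * T, mul_mem_span_range_Q hS hT, fun c => ?_⟩
    rw [mul_apply_eq_comp, hT']
    simp only [Finset.forall_mem_insert]
    by_cases h2 : ∀ x ∈ Λ, c.1 x = d.1 x
    · rw [if_pos h2, hS', ite_smul, one_smul, zero_smul]
      exact if_congr (and_iff_left h2).symm rfl rfl
    · rw [if_neg h2, map_zero, if_neg fun h => h2 h.2]

theorem proj_mem_span_range_Q (Λ : Finset (Simplex K)) (d : LocalConf K G Λ) :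
    proj Λ d ∈ Submodule.span ℂ (Set.range (Q (K := K) (G := G))) := by
  classical
  obtain ⟨T, hT, hT'⟩ := exists_mem_span_range_Q_indicator Λ (extend Λ d)
  have : proj Λ d = T := by
    refine ext_ket fun c => ?_
    rw [proj_ket, hT']
    by_cases h : res Λ c = d
    · rw [if_pos h, if_pos]
      rintro x hx
      rw [← h, extend_res_apply hx]
    · rw [if_neg h, if_neg]
      refine fun h' => h (funext fun x => ?_)
      rw [← res_extend Λ d]
      exact h' x.1 x.2
  rwa [this]

/-- A matrix unit on Λ is a shift, hence some P_t, times a projection, which is a combination of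
Q_γ. -/
theorem localObservables_subset_span :
    localObservables K G ⊆ Submodule.span ℂ (weylMonomials K G) := by
  intro T hT
  obtain ⟨Λ, a, rfl⟩ := Set.mem_iUnion.1 hT
  refine Submodule.sum_mem _ fun d _ => Submodule.sum_mem _ fun d' _ =>
    Submodule.smul_mem _ _ ?_
  obtain ⟨t, ht⟩ := toConf_surjective (extend Λ d - extend Λ d')
  rw [← ht]
  exact P_mul_mem_span_weyl t (proj_mem_span_range_Q Λ d')

theorem localOp_mem_localAlgebra (Λ : Finset (Simplex K))
    (a : Matrix (LocalConf K G Λ) (LocalConf K G Λ) ℂ) : localOp Λ a ∈ localAlgebra K G Λ := by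
  refine ⟨Matrix.toEuclideanCLM (n := LocalConf K G Λ) (𝕜 := ℂ) a, ?_⟩
  exact congrArg (localOp Λ) ((Matrix.toEuclideanCLM (n := LocalConf K G Λ)
    (𝕜 := ℂ)).symm_apply_apply a)

theorem P_mem_localAlgebra {Λ : Finset (Simplex K)} {t : Hom₀ K G 0}
    (h : Family.support t.1 ⊆ Λ) : P t ∈ localAlgebra K G Λ := by
  classical
  -- The permutation matrix of translation by t on Λ; nothing is lost because t is supported in Λ.
  have : P t = localOp Λ (Matrix.of fun d d' => if d = res Λ (toConf t) + d' then 1 else 0) := by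
    refine ext_ket fun c => ?_
    rw [localOp_ket, Finset.sum_eq_single (res Λ (toConf t) + res Λ c)]
    · rw [Matrix.of_apply, if_pos rfl, one_smul, P_ket]
      congr 2
      have h1 : extend Λ (res Λ (toConf t) + res Λ c) =
          extend Λ (res Λ (toConf t)) + extend Λ (res Λ c) := by
        refine Subtype.ext (funext fun x => ?_)
        by_cases hx : x ∈ Λ <;> simp [extend, hx]
      rw [h1, add_sub_cancel_right, extend_res Λ fun x hx => h ⟨_, hx⟩]
    · intro d _ hd
      rw [Matrix.of_apply, if_neg hd, zero_smul]
    · simp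
  rw [this]
  exact localOp_mem_localAlgebra _ _

theorem Q_mem_localAlgebra {Λ : Finset (Simplex K)} {γ : DualHom₀ K G 0}
    (h : DualFamily.support γ.1 ⊆ Λ) : Q γ ∈ localAlgebra K G Λ := by
  have : Q γ = localOp Λ (Matrix.diagonal fun d => (pairing γ (extend Λ d) : ℂ)) := by
    refine ext_ket fun c => ?_
    rw [localOp_ket, Finset.sum_eq_single (res Λ c)]
    · rw [Matrix.diagonal_apply_eq, sub_self, zero_add, Q_ket]
      congr 2
      rw [pairing_eq_prod_of_support_subset γ h, pairing_eq_prod_of_support_subset γ h]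
      refine Finset.prod_congr rfl fun x hx => ?_
      rw [extend_res_apply hx]
    · intro d _ hd
      rw [Matrix.diagonal_apply_ne _ hd, zero_smul]
    · simp
  rw [this]
  exact localOp_mem_localAlgebra _ _

theorem span_weylMonomials_subset :
    (Submodule.span ℂ (weylMonomials K G) : Set (H K G →L[ℂ] H K G)) ⊆ localObservables K G := by
  classical
  intro T hT
  -- Asking for all larger Λ lets two summands share a union, without a separate proof that the
  -- local algebras increase with Λ.
  suffices h : ∃ Λ₀ : Finset (Simplex K), ∀ Λ, Λ₀ ⊆ Λ → T ∈ localAlgebra K G Λ by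
    obtain ⟨Λ, h⟩ := h
    exact Set.mem_iUnion.2 ⟨Λ, h Λ subset_rfl⟩
  induction hT using Submodule.span_induction with
  | mem X hX =>
    obtain ⟨t, γ, rfl⟩ := hX
    refine ⟨t.2.2.toFinset ∪ γ.2.2.toFinset, fun Λ hΛ => mul_mem ?_ ?_⟩
    · exact P_mem_localAlgebra fun x hx => hΛ (by simp [hx])
    · exact Q_mem_localAlgebra fun x hx => hΛ (by simp [hx])
  | zero => exact ⟨∅, fun Λ _ => zero_mem _⟩
  | add X Y _ _ hX hY =>
    obtain ⟨Λ₁, h₁⟩ := hX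
    obtain ⟨Λ₂, h₂⟩ := hY
    exact ⟨Λ₁ ∪ Λ₂, fun Λ hΛ => add_mem (h₁ Λ (Finset.union_subset_left hΛ))
      (h₂ Λ (Finset.union_subset_right hΛ))⟩
  | smul a X _ hX =>
    obtain ⟨Λ₁, h₁⟩ := hX
    exact ⟨Λ₁, fun Λ hΛ => SMulMemClass.smul_mem a (h₁ Λ hΛ)⟩

/-! ### The two inclusions -/

theorem span_units_subset_commutant :
    (Submodule.span ℂ (units K G) : Set (H K G →L[ℂ] H K G)) ⊆ commutant K G := by
  intro T hT
  refine ⟨subset_closure (span_weylMonomials_subset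
    (Submodule.span_mono units_subset_weylMonomials hT)), mem_centralizer_coreAlgebra ?_⟩
  intro U hU
  induction hT using Submodule.span_induction with
  | mem W hW => exact coreGenerators_mul_of_mem_units hU hW
  | zero => rw [mul_zero, zero_mul]
  | add X Y _ _ hX hY => rw [mul_add, add_mul, hX, hY]
  | smul a X _ hX => rw [mul_smul_comm, smul_mul_assoc, hX]

theorem isClosed_commutant : IsClosed (commutant K G) :=
  isClosed_closure.inter (Set.isClosed_centralizer _)

theorem commutant_subset_closure_span_units :
    commutant K G ⊆ closure (Submodule.span ℂ (units K G) : Set (H K G →L[ℂ] H K G)) := by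
  rintro T ⟨hT, hcomm⟩
  rw [Metric.mem_closure_iff]
  intro ε hε
  obtain ⟨T₀, hT₀, hlt⟩ := Metric.mem_closure_iff.1 hT ε hε
  obtain ⟨T₁, hT₁, hle⟩ := exists_mem_span_norm_sub_le (𝒰 := coreGenerators K G) (T := T)
    (fun U hU => coreGenerators_norm_le hU)
    (fun U hU W hW => exists_coreGenerators_mul_weyl hU hW)
    (fun U hU W hW => coreGenerators_mul_of_mem_units hU hW)
    (fun W hW hn => exists_root_of_unity_of_notMem_units hW hn)
    (fun U hU => hcomm U (subset_closure (StarAlgebra.subset_adjoin ℂ _ hU)))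
    (localObservables_subset_span hT₀)
  refine ⟨T₁, hT₁, ?_⟩
  rw [dist_eq_norm] at hlt ⊢
  exact hle.trans_lt hlt

end Weyl

end HAQDM

theorem mainTheorem7 {V : Type*} [LinearOrder V] {N L : ℕ}
    (K : HAQDM.OrientedComplex V N L)
    (G : ChainComplex AddCommGrpCat ℤ) [∀ j, Finite (G.X j)]
    (_hG : ∀ j : ℤ, j < 0 ∨ (N : ℤ) < j → Subsingleton (G.X j)) :
    HAQDM.commutant K G =
      closure (Submodule.span ℂ (HAQDM.units K G) :
        Set (HAQDM.H K G →L[ℂ] HAQDM.H K G)) :=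
  HAQDM.commutant_subset_closure_span_units.antisymm
    (closure_minimal HAQDM.span_units_subset_commutant HAQDM.isClosed_commutant)
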